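/- **Proposition 5 (Moderate deviations).** Let $\mu$ be a probability measure on $\mathbb{R}^d$, let $H:\mathbb{R}^d\to\mathbb{R}^n$ be measurable and let $y\in\mathbb{R}^n$. For $\theta\in\mathbb{R}^n$ put $K(\theta)=\log\int e^{\langle\theta,H(x)\rangle}\,\mu(dx)\in(-\infty,+\infty]$. Assume that $\Theta=\{\theta: K(\theta)<\infty\}$ is open (which holds with $\Theta=\mathbb{R}^n$ if $H$ is bounded) and that no affine hyperplane of $\mathbb{R}^n$ contains $H(x)$ for $\mu$-almost every $x$. For $\theta\in\Theta$ let $\mu_\theta(dx)=e^{\langle\theta,H(x)\rangle-K(\theta)}\mu(dx)$, let $\theta_*$ be the unique minimizer over $\mathbb{R}^n$ of $J(\theta)=\tfrac12\|\theta-y\|^2+K(\theta)$, and put $\pi=\mu_{\theta_*}$. For $N\ge 1$ let $\pi_N$ be the probability measure on $(\mathbb{R}^d)^N$ $$\pi_N(dx)=C_N^{-1}\exp\Big(\sum_{i=1}^N\langle y,H(x_i)\rangle-\frac1{2N}\sum_{i,j=1}^N\langle H(x_i),H(x_j)\rangle\Big)\bigotimes_{i=1}^N\mu(dx_i),$$ where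 $C_N$ is the normalizing constant. Let $g:\mathbb{R}^d\to\mathbb{R}^m$ be bounded and measurable. Then there is a constant $c>0$ (depending on $\mu,H,y,g$ only) such that for every real sequence $(\lambda_N)_{N\ge1}$ with $\lambda_N\to\infty$ and $\lambda_N^2/N\to0$, $$\pi_N\left(\left|\frac1N\sum_{i=1}^N g(x_i)-\int g\,d\pi\right|\ge\frac{\lambda_N}{\sqrt N}\right)\le e^{-c\lambda_N^2+o(\lambda_N^2)}\qquad(N\to\infty),$$ where $|\cdot|$ is the Euclidean norm on $\mathbb{R}^m$. -/

import Mathlib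

open MeasureTheory Filter Topology Asymptotics
open scoped RealInnerProductSpace ENNReal

namespace MeanField

noncomputable section

/-- The cumulant generating function `K(θ) = log ∫ exp ⟨θ, H(x)⟩ μ(dx)`, extended by `+∞` to the
`θ` for which the integral diverges. -/
def cumulant {d n : ℕ} (μ : Measure (EuclideanSpace ℝ (Fin d)))
    (H : EuclideanSpace ℝ (Fin d) → EuclideanSpace ℝ (Fin n))
    (θ : EuclideanSpace ℝ (Fin n)) : EReal :=
  ENNReal.log (∫⁻ x, ENNReal.ofReal (Real.exp ⟪θ, H x⟫) ∂μ)

/-- The effective domain `Θ = {θ : K(θ) < ∞}`. -/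
def cumulantDomain {d n : ℕ} (μ : Measure (EuclideanSpace ℝ (Fin d)))
    (H : EuclideanSpace ℝ (Fin d) → EuclideanSpace ℝ (Fin n)) :
    Set (EuclideanSpace ℝ (Fin n)) :=
  {θ | cumulant μ H θ < ⊤}

/-- The exponential family `μ_θ(dx) = exp (⟨θ, H(x)⟩ - K(θ)) μ(dx)`. -/
def expFamily {d n : ℕ} (μ : Measure (EuclideanSpace ℝ (Fin d)))
    (H : EuclideanSpace ℝ (Fin d) → EuclideanSpace ℝ (Fin n))
    (θ : EuclideanSpace ℝ (Fin n)) : Measure (EuclideanSpace ℝ (Fin d)) :=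
  μ.tilted fun x => ⟪θ, H x⟫

/-- `J(θ) = ‖θ - y‖² / 2 + K(θ)`, with values in `(-∞, +∞]`. -/
def objective {d n : ℕ} (μ : Measure (EuclideanSpace ℝ (Fin d)))
    (H : EuclideanSpace ℝ (Fin d) → EuclideanSpace ℝ (Fin n))
    (y θ : EuclideanSpace ℝ (Fin n)) : EReal :=
  ((1 / 2 * ‖θ - y‖ ^ 2 : ℝ) : EReal) + cumulant μ H θ

/-- The minimizer `θ_*` of `J`; it exists and is unique by `existsUnique_isMinOn_objective`. -/
def thetaStar {d n : ℕ} (μ : Measure (EuclideanSpace ℝ (Fin d)))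
    (H : EuclideanSpace ℝ (Fin d) → EuclideanSpace ℝ (Fin n))
    (y : EuclideanSpace ℝ (Fin n)) : EuclideanSpace ℝ (Fin n) :=
  Classical.epsilon fun θ => IsMinOn (objective μ H y) Set.univ θ

/-- The mean-field limit `π = μ_{θ_*}`. -/
def limitMeasure {d n : ℕ} (μ : Measure (EuclideanSpace ℝ (Fin d)))
    (H : EuclideanSpace ℝ (Fin d) → EuclideanSpace ℝ (Fin n))
    (y : EuclideanSpace ℝ (Fin n)) : Measure (EuclideanSpace ℝ (Fin d)) :=
  expFamily μ H (thetaStar μ H y)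

/-- The posterior
`π_N(dx) = C_N⁻¹ exp (∑ᵢ ⟨y, H(xᵢ)⟩ - (1 / 2N) ∑ᵢⱼ ⟨H(xᵢ), H(xⱼ)⟩) ⨂ᵢ μ(dxᵢ)`
on `(ℝ^d)^N`, where `C_N` is the normalizing constant. -/
def posterior {d n : ℕ} (μ : Measure (EuclideanSpace ℝ (Fin d)))
    (H : EuclideanSpace ℝ (Fin d) → EuclideanSpace ℝ (Fin n))
    (y : EuclideanSpace ℝ (Fin n)) (N : ℕ) :
    Measure (Fin N → EuclideanSpace ℝ (Fin d)) :=
  (Measure.pi fun _ : Fin N => μ).tilted fun x =>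
    (∑ i, ⟪y, H (x i)⟫) - 1 / (2 * (N : ℝ)) * ∑ i, ∑ j, ⟪H (x i), H (x j)⟫

section Lemmas

variable {d n : ℕ} {μ : Measure (EuclideanSpace ℝ (Fin d))}
  {H : EuclideanSpace ℝ (Fin d) → EuclideanSpace ℝ (Fin n)}

theorem objective_eq_log (hH : Measurable H) (y θ : EuclideanSpace ℝ (Fin n)) :
    objective μ H y θ =
      ENNReal.log (∫⁻ x, ENNReal.ofReal (Real.exp (1 / 2 * ‖θ - y‖ ^ 2 + ⟪θ, H x⟫)) ∂μ) := by
  have h : ∀ x, ENNReal.ofReal (Real.exp (1 / 2 * ‖θ - y‖ ^ 2 + ⟪θ, H x⟫)) =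
      ENNReal.ofReal (Real.exp (1 / 2 * ‖θ - y‖ ^ 2)) * ENNReal.ofReal (Real.exp ⟪θ, H x⟫) := by
    intro x
    rw [Real.exp_add, ENNReal.ofReal_mul (Real.exp_pos _).le]
  simp_rw [h]
  rw [lintegral_const_mul _ (by fun_prop), ENNReal.log_mul_add,
    ENNReal.log_ofReal_of_pos (Real.exp_pos _), Real.log_exp]
  rfl

theorem existsUnique_isMinOn_objective [IsProbabilityMeasure μ] (hH : Measurable H)
    (y : EuclideanSpace ℝ (Fin n)) :
    ∃! θ, IsMinOn (objective μ H y) Set.univ θ := by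
  set L : EuclideanSpace ℝ (Fin n) → ℝ≥0∞ := fun θ =>
    ∫⁻ x, ENNReal.ofReal (Real.exp (1 / 2 * ‖θ - y‖ ^ 2 + ⟪θ, H x⟫)) ∂μ with hL
  have hmin : ∀ θ, IsMinOn (objective μ H y) Set.univ θ ↔ ∀ θ', L θ ≤ L θ' := by
    intro θ
    simp [isMinOn_iff, objective_eq_log hH, hL]
  simp_rw [hmin]
  have hL0 : L 0 < ⊤ := by simp [hL]
  have hlsc : LowerSemicontinuous L := by
    rw [lowerSemicontinuous_iff_isClosed_preimage]
    intro a
    refine IsSeqClosed.isClosed fun u θ hu hlim => ?_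
    have hF : ∀ x, Tendsto
        (fun k => ENNReal.ofReal (Real.exp (1 / 2 * ‖u k - y‖ ^ 2 + ⟪u k, H x⟫))) atTop
        (𝓝 (ENNReal.ofReal (Real.exp (1 / 2 * ‖θ - y‖ ^ 2 + ⟪θ, H x⟫)))) := by
      intro x
      have hc : Continuous fun t : EuclideanSpace ℝ (Fin n) =>
          ENNReal.ofReal (Real.exp (1 / 2 * ‖t - y‖ ^ 2 + ⟪t, H x⟫)) :=
        ENNReal.continuous_ofReal.comp (by fun_prop)
      exact (hc.tendsto θ).comp hlim
    have h1 : L θ ≤ liminf (fun k => L (u k)) atTop := by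
      have : L θ = ∫⁻ x, liminf (fun k =>
          ENNReal.ofReal (Real.exp (1 / 2 * ‖u k - y‖ ^ 2 + ⟪u k, H x⟫))) atTop ∂μ :=
        lintegral_congr fun x => (hF x).liminf_eq.symm
      rw [this]
      exact lintegral_liminf_le fun k => by fun_prop
    refine h1.trans ?_
    have h2 : liminf (fun k => L (u k)) atTop ≤ liminf (fun _ : ℕ => a) atTop :=
      liminf_le_liminf (Eventually.of_forall fun k => hu k)
    simpa using h2
  obtain ⟨R, hR⟩ : ∃ R : ℕ, 0 < μ {x | ‖H x‖ ≤ R} := by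
    by_contra! hcon
    have hU : (⋃ R : ℕ, {x | ‖H x‖ ≤ R}) = Set.univ := by
      ext x
      simpa using exists_nat_ge ‖H x‖
    have h0 : μ (⋃ R : ℕ, {x | ‖H x‖ ≤ R}) = 0 :=
      measure_iUnion_null fun R => le_antisymm (hcon R) zero_le
    rw [hU, measure_univ] at h0
    exact one_ne_zero h0
  have hlow : ∀ θ, ENNReal.ofReal (Real.exp (1 / 2 * ‖θ - y‖ ^ 2 - R * ‖θ‖)) *
      μ {x | ‖H x‖ ≤ R} ≤ L θ := by
    intro θ
    have hms : MeasurableSet {x | ‖H x‖ ≤ R} := measurableSet_le (by fun_prop) (by fun_prop)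
    rw [← setLIntegral_const]
    refine le_trans (setLIntegral_mono (by fun_prop) fun x hx => ?_) (setLIntegral_le_lintegral _ _)
    refine ENNReal.ofReal_le_ofReal (Real.exp_le_exp.2 ?_)
    have hi := neg_le_of_abs_le (abs_real_inner_le_norm θ (H x))
    have hx' : ‖H x‖ ≤ R := hx
    nlinarith [norm_nonneg θ]
  have hexp : Tendsto (fun θ : EuclideanSpace ℝ (Fin n) =>
      1 / 2 * ‖θ - y‖ ^ 2 - R * ‖θ‖) (cocompact _) atTop := by
    have ht : Tendsto (fun t : ℝ => t * (1 / 2 * t - (‖y‖ + R))) atTop atTop :=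
      tendsto_id.atTop_mul_atTop₀ (tendsto_atTop_add_const_right _ _
        (tendsto_id.const_mul_atTop (by norm_num)))
    refine tendsto_atTop_mono (fun θ => ?_) (ht.comp tendsto_norm_cocompact_atTop)
    have h1 := norm_sub_sq_real θ y
    have h2 := real_inner_le_norm θ y
    simp only [Function.comp]
    nlinarith [sq_nonneg ‖y‖]
  have hcoer : ∀ᶠ θ in cocompact _, L 0 ≤ L θ := by
    have h1 : Tendsto (fun θ : EuclideanSpace ℝ (Fin n) =>
        ENNReal.ofReal (Real.exp (1 / 2 * ‖θ - y‖ ^ 2 - R * ‖θ‖)) * μ {x | ‖H x‖ ≤ R})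
        (cocompact _) (𝓝 ⊤) := by
      have := ENNReal.Tendsto.mul_const (b := μ {x | ‖H x‖ ≤ R})
        (ENNReal.tendsto_ofReal_atTop.comp (Real.tendsto_exp_atTop.comp hexp)) (Or.inl (by simp))
      rwa [ENNReal.top_mul hR.ne'] at this
    filter_upwards [h1.eventually (lt_mem_nhds hL0)] with θ hθ
    exact hθ.le.trans (hlow θ)
  obtain ⟨s, hs, hsub⟩ := mem_cocompact.1 hcoer
  obtain ⟨θ, -, hθ⟩ := LowerSemicontinuousOn.exists_isMinOn (f := L) (s := insert 0 s)
    (Set.insert_nonempty _ _) (hs.insert 0) (hlsc.lowerSemicontinuousOn _)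
  have hθmin : ∀ θ', L θ ≤ L θ' := by
    intro θ'
    by_cases h : θ' ∈ s
    · exact hθ (Set.mem_insert_of_mem _ h)
    · exact (hθ (Set.mem_insert _ _)).trans (hsub h)
  refine ⟨θ, hθmin, fun θ' hθ' => ?_⟩
  by_contra hne
  have heq : L θ' = L θ := le_antisymm (hθ' θ) (hθmin θ')
  have hfin : L θ ≠ ⊤ := ((hθmin 0).trans_lt hL0).ne
  have hpos : L θ ≠ 0 := by
    have := (ENNReal.mul_pos (by simpa using Real.exp_pos _) hR.ne').trans_le (hlow θ)
    exact this.ne'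
  set q : ℝ := 1 / 8 * ‖θ' - θ‖ ^ 2 with hq
  have hq0 : 0 < q := by
    have : 0 < ‖θ' - θ‖ := norm_pos_iff.2 (sub_ne_zero.2 hne)
    positivity
  set p : EuclideanSpace ℝ (Fin n) := (1 / 2 : ℝ) • (θ' + θ) with hp
  have hconv : ∀ x, Real.exp (1 / 2 * ‖p - y‖ ^ 2 + ⟪p, H x⟫) ≤
      Real.exp (-q) / 2 * (Real.exp (1 / 2 * ‖θ' - y‖ ^ 2 + ⟪θ', H x⟫) +
        Real.exp (1 / 2 * ‖θ - y‖ ^ 2 + ⟪θ, H x⟫)) := by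
    intro x
    set A := 1 / 2 * ‖θ' - y‖ ^ 2 + ⟪θ', H x⟫ with hA
    set B := 1 / 2 * ‖θ - y‖ ^ 2 + ⟪θ, H x⟫ with hB
    have hid : 1 / 2 * ‖p - y‖ ^ 2 + ⟪p, H x⟫ = -q + (A / 2 + B / 2) := by
      have e1 : p - y = (1 / 2 : ℝ) • ((θ' - y) + (θ - y)) := by
        rw [hp]
        module
      have e2 : ‖θ' - θ‖ ^ 2 =
          ‖θ' - y‖ ^ 2 - 2 * ⟪θ' - y, θ - y⟫ + ‖θ - y‖ ^ 2 := by
        rw [← norm_sub_sq_real, sub_sub_sub_cancel_right]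
      rw [hA, hB, hq, e2, e1, norm_smul, hp, inner_smul_left, inner_add_left, mul_pow,
        norm_add_sq_real (θ' - y)]
      norm_num
      ring
    have hAM : Real.exp (A / 2 + B / 2) ≤ (Real.exp A + Real.exp B) / 2 := by
      have ea : Real.exp A = Real.exp (A / 2) ^ 2 := by rw [← Real.exp_nat_mul]; ring_nf
      have eb : Real.exp B = Real.exp (B / 2) ^ 2 := by rw [← Real.exp_nat_mul]; ring_nf
      rw [ea, eb, Real.exp_add]
      nlinarith [sq_nonneg (Real.exp (A / 2) - Real.exp (B / 2))]
    rw [hid, Real.exp_add]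
    nlinarith [Real.exp_pos (-q)]
  have hle : L p ≤ ENNReal.ofReal (Real.exp (-q)) * L θ := by
    calc L p ≤ ∫⁻ x, ENNReal.ofReal (Real.exp (-q) / 2) *
          (ENNReal.ofReal (Real.exp (1 / 2 * ‖θ' - y‖ ^ 2 + ⟪θ', H x⟫)) +
            ENNReal.ofReal (Real.exp (1 / 2 * ‖θ - y‖ ^ 2 + ⟪θ, H x⟫))) ∂μ := by
          refine lintegral_mono fun x => ?_
          rw [← ENNReal.ofReal_add (Real.exp_pos _).le (Real.exp_pos _).le,
            ← ENNReal.ofReal_mul (by positivity)]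
          exact ENNReal.ofReal_le_ofReal (hconv x)
      _ = ENNReal.ofReal (Real.exp (-q) / 2) * (L θ' + L θ) := by
          rw [lintegral_const_mul _ (by fun_prop), lintegral_add_left (by fun_prop)]
      _ = ENNReal.ofReal (Real.exp (-q)) * L θ := by
          rw [heq, ← two_mul, ← mul_assoc]
          congr 1
          rw [← ENNReal.ofReal_ofNat 2, ← ENNReal.ofReal_mul (by positivity)]
          congr 1
          ring
  have hlt : ENNReal.ofReal (Real.exp (-q)) * L θ < L θ := by
    have : ENNReal.ofReal (Real.exp (-q)) < 1 := by
      rw [ENNReal.ofReal_lt_one]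
      exact Real.exp_lt_one_iff.2 (by linarith)
    calc _ < 1 * L θ := (ENNReal.mul_lt_mul_iff_left hpos hfin).2 this
      _ = L θ := one_mul _
  exact absurd (hθmin p) (not_le.2 (hle.trans_lt hlt))

theorem isMinOn_thetaStar [IsProbabilityMeasure μ] (hH : Measurable H)
    (y : EuclideanSpace ℝ (Fin n)) :
    IsMinOn (objective μ H y) Set.univ (thetaStar μ H y) :=
  Classical.epsilon_spec (existsUnique_isMinOn_objective hH y).exists

theorem isProbabilityMeasure_posterior [IsProbabilityMeasure μ] (hH : Measurable H)
    (y : EuclideanSpace ℝ (Fin n)) {N : ℕ} (hN : 1 ≤ N) :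
    IsProbabilityMeasure (posterior μ H y N) := by
  refine isProbabilityMeasure_tilted
    (Integrable.of_bound (C := Real.exp (N / 2 * ‖y‖ ^ 2)) (by fun_prop) (ae_of_all _ fun x => ?_))
  rw [Real.norm_of_nonneg (Real.exp_pos _).le, Real.exp_le_exp]
  have hN' : (0 : ℝ) < N := by exact_mod_cast hN
  set S := ∑ i, H (x i) with hS
  have h1 : ∑ i, ⟪y, H (x i)⟫ = ⟪y, S⟫ := by rw [hS, inner_sum]
  have h2 : ∑ i, ∑ j, ⟪H (x i), H (x j)⟫ = ‖S‖ ^ 2 := by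
    rw [← real_inner_self_eq_norm_sq, hS, sum_inner]
    simp_rw [inner_sum]
  rw [h1, h2]
  have h3 := real_inner_le_norm y S
  have h4 : ‖y‖ * ‖S‖ ≤ N / 2 * ‖y‖ ^ 2 + 1 / (2 * (N : ℝ)) * ‖S‖ ^ 2 := by
    have h5 : 0 ≤ 1 / (2 * (N : ℝ)) * (N * ‖y‖ - ‖S‖) ^ 2 := by positivity
    have h6 : 1 / (2 * (N : ℝ)) * (N * ‖y‖ - ‖S‖) ^ 2 =
        N / 2 * ‖y‖ ^ 2 + 1 / (2 * (N : ℝ)) * ‖S‖ ^ 2 - ‖y‖ * ‖S‖ := by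
      field_simp
      ring
    linarith
  linarith

end Lemmas

end

end MeanField

namespace MeanField

open ProbabilityTheory

/-! ### Exponential tilting: products, reweighting, Jensen. -/

section Tilting

variable {α : Type*} {mα : MeasurableSpace α}

/-! Completing the square turns the posterior into the product measure `π^{⊗N}` reweighted by `exp
(-(N/2) ‖H̄ - (y - θ_*)‖²)`, where `H̄` is the empirical mean of `H`
(`posterior_eq_tilted_pi_limitMeasure`). The weight is at most 1, so only its normalizing constant
can make the posterior exceed the product measure.

Stationarity of `J` at `θ_*` says that `H` has `π`-mean `y - θ_*` (`integral_inner_limitMeasure`).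
The quadratic term is thus centred: by independence its expectation is half the total variance of
`H` under `π`, whatever `N` is, and Jensen's inequality bounds the constant below uniformly in `N`
(`le_integral_exp_neg_sq_average`). Hence the posterior is dominated by a fixed multiple of
`π^{⊗N}`, under which Hoeffding's inequality for the bounded `g` gives the Gaussian tail. The error
in the exponent is in fact eventually constant. -/

theorem tilted_add_const (μ : Measure α) (f : α → ℝ) (c : ℝ) :
    μ.tilted (fun x => f x + c) = μ.tilted f := by
  have h : ∀ x, Real.exp (f x + c) / ∫ z, Real.exp (f z + c) ∂μ =
      Real.exp (f x) / ∫ z, Real.exp (f z) ∂μ := fun x => by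
    simp_rw [Real.exp_add]
    rw [integral_mul_const, mul_div_mul_right _ _ (Real.exp_pos c).ne']
  simp_rw [Measure.tilted, h]

/-- A product of exponentially tilted measures is an exponentially tilted product. -/
theorem pi_tilted {ι : Type*} [Fintype ι] (μ : Measure α) [IsProbabilityMeasure μ] {f : α → ℝ}
    (hf : Integrable (fun x => Real.exp (f x)) μ) :
    Measure.pi (fun _ : ι => μ.tilted f) =
      (Measure.pi fun _ : ι => μ).tilted fun x => ∑ i, f (x i) := by
  have := isProbabilityMeasure_tilted hf
  refine Measure.pi_eq fun s hs => ?_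
  rw [tilted_apply_eq_ofReal_integral' _ (MeasurableSet.univ_pi hs), Measure.restrict_pi_pi]
  simp_rw [fun i => tilted_apply_eq_ofReal_integral' (μ := μ) f (hs i), integral_div, Real.exp_sum]
  rw [integral_fintype_prod_eq_prod (fun _ z => Real.exp (f z)),
    integral_fintype_prod_eq_prod (fun _ z => Real.exp (f z)), ← Finset.prod_div_distrib,
    ENNReal.ofReal_prod_of_nonneg]
  exact fun i _ => by positivity

/-- Tilting by a nonpositive function increases probabilities at most by the reciprocal of the
normalizing constant. -/
theorem tilted_apply_le_of_nonpos (P : Measure α) [SFinite P] {V : α → ℝ} (hV : ∀ x, V x ≤ 0)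
    {z : ℝ} (hz : 0 < z) (hzV : z ≤ ∫ x, Real.exp (V x) ∂P) (s : Set α) :
    P.tilted V s ≤ ENNReal.ofReal z⁻¹ * P s := by
  rw [tilted_apply, ← setLIntegral_const]
  refine lintegral_mono fun x => ENNReal.ofReal_le_ofReal ?_
  rw [div_eq_mul_inv]
  calc Real.exp (V x) * (∫ x, Real.exp (V x) ∂P)⁻¹ ≤ 1 * z⁻¹ := by
        gcongr
        exact Real.exp_le_one_iff.2 (hV x)
    _ = z⁻¹ := one_mul _

/-- Jensen's inequality for the exponential of a nonpositive integrable function. -/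
theorem exp_integral_le_integral_exp (P : Measure α) [IsProbabilityMeasure P] {V : α → ℝ}
    (hV : ∀ x, V x ≤ 0) (hVi : Integrable V P) :
    Real.exp (∫ x, V x ∂P) ≤ ∫ x, Real.exp (V x) ∂P := by
  have hexp : Integrable (fun x => Real.exp (V x)) P := by
    refine Integrable.of_bound (C := 1) (Real.continuous_exp.comp_aestronglyMeasurable hVi.1)
      (ae_of_all _ fun x => ?_)
    rw [Real.norm_of_nonneg (Real.exp_pos _).le]
    exact Real.exp_le_one_iff.2 (hV x)
  exact convexOn_exp.map_integral_le Real.continuous_exp.continuousOn isClosed_univ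
    (ae_of_all _ fun _ => Set.mem_univ _) hVi hexp

end Tilting

/-! ### Second moments and Hoeffding bounds for independent samples. -/

section Product

variable {α : Type*} {mα : MeasurableSpace α} (ν : Measure α) [IsProbabilityMeasure ν]

theorem integrable_sq_average_sub {Y : α → ℝ} (hY : MemLp Y 2 ν) (N : ℕ) :
    Integrable (fun x : Fin N → α => (1 / (N : ℝ) * ∑ i, Y (x i) - ∫ z, Y z ∂ν) ^ 2)
      (Measure.pi fun _ => ν) := by
  have h : ∀ i : Fin N, MemLp (fun x : Fin N → α => Y (x i)) 2 (Measure.pi fun _ => ν) :=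
    fun i => hY.comp_measurePreserving (measurePreserving_eval _ i)
  exact (((memLp_finsetSum _ fun i _ => h i).const_mul _).sub (memLp_const _)).integrable_sq

theorem integral_sq_average_sub {Y : α → ℝ} (hY : MemLp Y 2 ν) {N : ℕ} (hN : 1 ≤ N) :
    ∫ x : Fin N → α, (1 / (N : ℝ) * ∑ i, Y (x i) - ∫ z, Y z ∂ν) ^ 2 ∂(Measure.pi fun _ => ν) =
      Var[Y; ν] / N := by
  have hN' : (N : ℝ) ≠ 0 := by positivity
  have h : ∀ i : Fin N, MemLp (fun x : Fin N → α => Y (x i)) 2 (Measure.pi fun _ => ν) :=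
    fun i => hY.comp_measurePreserving (measurePreserving_eval _ i)
  have hmean : ∫ x : Fin N → α, ∑ i, Y (x i) ∂(Measure.pi fun _ => ν) = N * ∫ z, Y z ∂ν := by
    rw [integral_finsetSum _ fun i _ => (h i).integrable (by norm_num)]
    simp_rw [fun i : Fin N => integral_comp_eval (μ := fun _ : Fin N => ν) (i := i)
      hY.aestronglyMeasurable]
    simp
  have hvar : Var[fun x : Fin N → α => ∑ i, Y (x i); Measure.pi fun _ => ν] = N * Var[Y; ν] := by
    have := variance_sum_pi (μ := fun _ : Fin N => ν) (X := fun _ => Y) fun _ => hY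
    simp only [Finset.sum_const, Finset.card_univ, Fintype.card_fin, nsmul_eq_mul] at this
    rw [← this]
    congr 1
    ext x
    simp
  rw [variance_eq_integral (memLp_finsetSum _ fun i _ => h i).aestronglyMeasurable.aemeasurable,
    hmean] at hvar
  have hpt : ∀ x : Fin N → α, (1 / (N : ℝ) * ∑ i, Y (x i) - ∫ z, Y z ∂ν) ^ 2 =
      1 / (N : ℝ) ^ 2 * (∑ i, Y (x i) - N * ∫ z, Y z ∂ν) ^ 2 := fun x => by
    field_simp
  simp_rw [hpt]
  rw [integral_const_mul, hvar]
  field_simp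

/-- The normalizing constant of the Gaussian mean-field interaction stays bounded below. -/
theorem le_integral_exp_neg_sq_average {n : ℕ} {Y : α → EuclideanSpace ℝ (Fin n)}
    (hY : ∀ k, MemLp (fun x => Y x k) 2 ν) {a : EuclideanSpace ℝ (Fin n)}
    (ha : ∀ k, ∫ z, Y z k ∂ν = a k) {N : ℕ} (hN : 1 ≤ N) :
    Real.exp (-(1 / 2 * ∑ k, Var[fun x => Y x k; ν])) ≤
      ∫ x : Fin N → α, Real.exp (-(N / 2 * ‖(1 / (N : ℝ)) • ∑ i, Y (x i) - a‖ ^ 2))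
        ∂(Measure.pi fun _ => ν) := by
  have hN' : (N : ℝ) ≠ 0 := by positivity
  have hpt : ∀ x : Fin N → α, ‖(1 / (N : ℝ)) • ∑ i, Y (x i) - a‖ ^ 2 =
      ∑ k, (1 / (N : ℝ) * ∑ i, Y (x i) k - ∫ z, Y z k ∂ν) ^ 2 := fun x => by
    rw [EuclideanSpace.norm_sq_eq]
    refine Finset.sum_congr rfl fun k _ => ?_
    simp [ha k, WithLp.ofLp_sum]
  have hint := fun k => integrable_sq_average_sub ν (hY k) N
  have hI : Integrable (fun x : Fin N → α =>
      -(N / 2 * ‖(1 / (N : ℝ)) • ∑ i, Y (x i) - a‖ ^ 2)) (Measure.pi fun _ => ν) := by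
    simp_rw [hpt]
    exact ((integrable_finsetSum _ fun k _ => hint k).const_mul _).neg
  -- The factor `N` in the exponent cancels the `1 / N` in the variance of the mean, so the bound
  -- does not depend on `N`.
  refine le_trans (le_of_eq ?_)
    (exp_integral_le_integral_exp _ (fun x => neg_nonpos.2 (by positivity)) hI)
  simp_rw [hpt]
  rw [integral_neg, integral_const_mul, integral_finsetSum _ fun k _ => hint k]
  simp_rw [fun k => integral_sq_average_sub ν (hY k) hN, ← Finset.sum_div]
  congr 2
  field_simp

/-- Hoeffding's inequality for sums of a bounded real function over independent samples. -/
theorem measure_abs_sum_sub_ge_le {Y : α → ℝ} (hYm : Measurable Y) {M : ℝ}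
    (hM : ∀ x, |Y x| ≤ M) (N : ℕ) {ε : ℝ} (hε : 0 ≤ ε) :
    (Measure.pi fun _ : Fin N => ν).real {x | ε ≤ |∑ i, (Y (x i) - ∫ z, Y z ∂ν)|} ≤
      2 * Real.exp (-ε ^ 2 / (2 * (N * M ^ 2))) := by
  have hsub : HasSubgaussianMGF (fun z => Y z - ∫ z, Y z ∂ν) ((‖M - -M‖₊ / 2) ^ 2) ν :=
    hasSubgaussianMGF_of_mem_Icc hYm.aemeasurable (ae_of_all _ fun x => abs_le.1 (hM x))
  have hsum : HasSubgaussianMGF (fun x : Fin N → α => ∑ i, (Y (x i) - ∫ z, Y z ∂ν))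
      (∑ _i : Fin N, (‖M - -M‖₊ / 2) ^ 2) (Measure.pi fun _ => ν) := by
    refine HasSubgaussianMGF.sum_of_iIndepFun
      (iIndepFun_pi (X := fun _ z => Y z - ∫ z, Y z ∂ν) fun i => by fun_prop) fun i _ => ?_
    have hmp := measurePreserving_eval (fun _ : Fin N => ν) i
    exact HasSubgaussianMGF.of_map (X := fun z => Y z - ∫ z, Y z ∂ν)
      hmp.measurable.aemeasurable (by rwa [hmp.map_eq])
  -- Each summand ranges over an interval of half-length `M`, hence has variance proxy `M ^ 2`.
  have hc : ((∑ _i : Fin N, (‖M - -M‖₊ / 2) ^ 2 : NNReal) : ℝ) = N * M ^ 2 := by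
    simp only [Finset.sum_const, Finset.card_univ, Fintype.card_fin, nsmul_eq_mul]
    push_cast
    rw [Real.norm_eq_abs, div_pow, sq_abs]
    ring
  have h1 := hsum.measure_ge_le hε
  have h2 := hsum.neg.measure_ge_le hε
  rw [hc] at h1 h2
  have hset : {x : Fin N → α | ε ≤ |∑ i, (Y (x i) - ∫ z, Y z ∂ν)|} ⊆
      {x | ε ≤ ∑ i, (Y (x i) - ∫ z, Y z ∂ν)} ∪
        {x | ε ≤ (-fun x : Fin N → α => ∑ i, (Y (x i) - ∫ z, Y z ∂ν)) x} :=
    fun x (hx : ε ≤ |_|) => (le_abs.1 hx :)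
  refine (measureReal_mono hset).trans ((measureReal_union_le _ _).trans ?_)
  linarith

/-- Hoeffding's inequality for the empirical mean of a bounded vector-valued function. -/
theorem measure_norm_average_sub_ge_le {m : ℕ} {g : α → EuclideanSpace ℝ (Fin m)}
    (hg : Measurable g) {M : ℝ} (hM : ∀ x, ‖g x‖ ≤ M) {N : ℕ} (hN : 1 ≤ N)
    {t : ℝ} (ht : 0 < t) :
    (Measure.pi fun _ : Fin N => ν).real
        {x | t ≤ ‖(1 / (N : ℝ)) • ∑ i, g (x i) - ∫ z, g z ∂ν‖} ≤
      2 * m * Real.exp (-(N * t ^ 2 / (2 * ((m + 1) * M) ^ 2))) := by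
  have hN' : (0 : ℝ) < N := by positivity
  have hgk : ∀ k, Measurable fun x => g x k := fun k => by fun_prop
  have hMk : ∀ k x, |g x k| ≤ M := fun k x =>
    (Real.norm_eq_abs _ ▸ PiLp.norm_apply_le (g x) k).trans (hM x)
  have hint : ∀ k, Integrable (fun x => g x k) ν := fun k =>
    Integrable.of_bound (hgk k).aestronglyMeasurable M (ae_of_all _ fun x => hMk k x)
  -- Dividing by `m + 1` instead of `m` makes the sum of the coordinate bounds strictly less than
  -- `t` and covers `m = 0`.
  set ε : ℝ := N * (t / (m + 1)) with hε
  have hset : {x : Fin N → α | t ≤ ‖(1 / (N : ℝ)) • ∑ i, g (x i) - ∫ z, g z ∂ν‖} ⊆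
      ⋃ k ∈ (Finset.univ : Finset (Fin m)),
        {x | ε ≤ |∑ i, (g (x i) k - ∫ z, g z k ∂ν)|} := by
    intro x hx
    by_contra hcon
    simp only [Finset.mem_univ, Set.iUnion_true, Set.mem_iUnion, Set.mem_ofPred_eq, not_exists,
      not_le] at hcon hx
    set v := (1 / (N : ℝ)) • ∑ i, g (x i) - ∫ z, g z ∂ν with hv
    have hvk : ∀ k, |v k| ≤ t / (m + 1) := fun k => by
      have e : v k = (1 / (N : ℝ)) * ∑ i, (g (x i) k - ∫ z, g z k ∂ν) := by
        simp [hv, WithLp.ofLp_sum, eval_integral_piLp hint, mul_sub, hN'.ne']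
      rw [e, abs_mul, abs_of_pos (by positivity)]
      calc 1 / (N : ℝ) * |∑ i, (g (x i) k - ∫ z, g z k ∂ν)| ≤ 1 / (N : ℝ) * ε := by
            gcongr
            exact (hcon k).le
        _ = t / (m + 1) := by rw [hε]; field_simp
    have hnorm : ‖v‖ ≤ ∑ k, |v k| := by
      rw [EuclideanSpace.norm_eq]
      refine Real.sqrt_le_iff.2 ⟨by positivity, ?_⟩
      exact Finset.sum_sq_le_sq_sum_of_nonneg fun k _ => abs_nonneg _
    have hsum : ∑ k, |v k| ≤ m * (t / (m + 1)) := by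
      simpa using Finset.sum_le_card_nsmul Finset.univ _ _ fun k _ => hvk k
    have hlt : m * (t / (m + 1)) < t := by
      rw [mul_div_assoc', div_lt_iff₀ (by positivity)]
      nlinarith
    linarith
  calc _ ≤ ∑ k : Fin m, (Measure.pi fun _ : Fin N => ν).real
        {x | ε ≤ |∑ i, (g (x i) k - ∫ z, g z k ∂ν)|} :=
        (measureReal_mono hset (measure_ne_top _ _)).trans (measureReal_biUnion_finset_le _ _)
    _ ≤ ∑ _k : Fin m, 2 * Real.exp (-ε ^ 2 / (2 * (N * M ^ 2))) :=
        Finset.sum_le_sum fun k _ => measure_abs_sum_sub_ge_le ν (hgk k) (hMk k) N (by positivity)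
    _ = _ := by
        rw [Finset.sum_const, Finset.card_univ, Fintype.card_fin, nsmul_eq_mul, hε, ← mul_assoc,
          mul_comm (m : ℝ) 2]
        congr 2
        -- For `M = 0` both exponents are divisions by zero, hence `0`.
        rcases eq_or_ne M 0 with rfl | hM0
        · simp
        · field_simp

end Product

/-! ### The minimizer, its first-order condition, and the posterior. -/

section FirstOrder

variable {d n : ℕ} {μ : Measure (EuclideanSpace ℝ (Fin d))}
  {H : EuclideanSpace ℝ (Fin d) → EuclideanSpace ℝ (Fin n)}

theorem mem_cumulantDomain_iff (hH : Measurable H) (θ : EuclideanSpace ℝ (Fin n)) :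
    θ ∈ cumulantDomain μ H ↔ Integrable (fun x => Real.exp ⟪θ, H x⟫) μ := by
  have hm : AEStronglyMeasurable (fun x => Real.exp ⟪θ, H x⟫) μ :=
    Measurable.aestronglyMeasurable (by fun_prop)
  simp only [cumulantDomain, cumulant, Set.mem_ofPred_eq, lt_top_iff_ne_top, ne_eq,
    ENNReal.log_eq_top_iff]
  rw [← lintegral_ofReal_ne_top_iff_integrable hm (ae_of_all _ fun x => (Real.exp_pos _).le)]

/-- Since `K(0) = 0`, the objective is finite at the origin, hence at its minimizer. -/
theorem thetaStar_mem_cumulantDomain [IsProbabilityMeasure μ] (hH : Measurable H)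
    (y : EuclideanSpace ℝ (Fin n)) : thetaStar μ H y ∈ cumulantDomain μ H := by
  have h := isMinOn_thetaStar (μ := μ) hH y (Set.mem_univ 0)
  by_contra hcon
  have htop : cumulant μ H (thetaStar μ H y) = ⊤ := not_lt_top_iff.1 hcon
  have h0 : objective μ H y 0 = ((1 / 2 * ‖0 - y‖ ^ 2 : ℝ) : EReal) := by
    simp [objective, cumulant]
  rw [Set.mem_ofPred_eq, h0, objective, htop, EReal.coe_add_top, top_le_iff] at h
  exact EReal.coe_ne_top _ h

theorem integrable_exp_inner_thetaStar [IsProbabilityMeasure μ] (hH : Measurable H)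
    (y : EuclideanSpace ℝ (Fin n)) :
    Integrable (fun x => Real.exp ⟪thetaStar μ H y, H x⟫) μ :=
  (mem_cumulantDomain_iff hH _).1 (thetaStar_mem_cumulantDomain hH y)

/-- Up to normalization, the moment generating function of `⟪v, H⟫` under the tilt at `θ` is the
original exponential integral at `θ + t • v`; openness of the domain keeps this finite for small
`t`. It yields both differentiability at `0` and finite moments. -/
theorem zero_mem_interior_integrableExpSet (hH : Measurable H)
    (hΘ : IsOpen (cumulantDomain μ H)) {θ : EuclideanSpace ℝ (Fin n)}
    (hθ : θ ∈ cumulantDomain μ H) (v : EuclideanSpace ℝ (Fin n)) :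
    0 ∈ interior (integrableExpSet (fun x => ⟪v, H x⟫) (expFamily μ H θ)) := by
  rw [mem_interior_iff_mem_nhds]
  have hc : Continuous fun t : ℝ => θ + t • v := by fun_prop
  have hnhds : ∀ᶠ t in 𝓝 (0 : ℝ), θ + t • v ∈ cumulantDomain μ H :=
    hc.continuousAt.eventually_mem (hΘ.mem_nhds (by simpa using hθ))
  filter_upwards [hnhds] with t ht
  rw [integrableExpSet, Set.mem_ofPred_eq, expFamily,
    integrable_tilted_iff ((mem_cumulantDomain_iff hH θ).1 hθ)]
  refine ((mem_cumulantDomain_iff hH _).1 ht).congr (ae_of_all _ fun x => ?_)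
  simp only [smul_eq_mul]
  rw [← Real.exp_add, inner_add_left, real_inner_smul_left]

/-- The first-order condition `θ_* - y + ∇K(θ_*) = 0` for the minimizer of the objective. -/
theorem integral_inner_limitMeasure [IsProbabilityMeasure μ] (hH : Measurable H)
    (y : EuclideanSpace ℝ (Fin n)) (hΘ : IsOpen (cumulantDomain μ H))
    (v : EuclideanSpace ℝ (Fin n)) :
    ∫ x, ⟪v, H x⟫ ∂(limitMeasure μ H y) = ⟪v, y - thetaStar μ H y⟫ := by
  set θ := thetaStar μ H y with hθdef
  have hθ : θ ∈ cumulantDomain μ H := thetaStar_mem_cumulantDomain hH y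
  have hθi := (mem_cumulantDomain_iff hH θ).1 hθ
  set Z := ∫ x, Real.exp ⟪θ, H x⟫ ∂μ with hZ
  have hZpos : 0 < Z := integral_exp_pos hθi
  have hint := zero_mem_interior_integrableExpSet hH hΘ hθ v
  have : IsProbabilityMeasure (limitMeasure μ H y) := isProbabilityMeasure_tilted hθi
  set X : EuclideanSpace ℝ (Fin d) → ℝ := fun x => ⟪v, H x⟫ with hX
  -- Along the line `θ + t • v`, `exp J` is thus `Z` times an explicit smooth factor times an `mgf`,
  -- whose derivative at `0` is the mean of `X`.
  have hmgf : ∀ t, ∫ x, Real.exp ⟪θ + t • v, H x⟫ ∂μ = Z * mgf X (limitMeasure μ H y) t := by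
    intro t
    rw [mgf, limitMeasure, expFamily, integral_exp_tilted, ← hθdef, mul_div_cancel₀ _ hZpos.ne']
    refine integral_congr_ae (ae_of_all _ fun x => ?_)
    simp only [Pi.add_apply, hX]
    rw [inner_add_left, real_inner_smul_left]
  set q : ℝ → ℝ := fun t => 1 / 2 * ‖θ + t • v - y‖ ^ 2 with hq
  have hobj : ∀ t, θ + t • v ∈ cumulantDomain μ H → objective μ H y (θ + t • v) =
      ENNReal.log (ENNReal.ofReal (Real.exp (q t) * (Z * mgf X (limitMeasure μ H y) t))) := by
    intro t ht
    have hti := (mem_cumulantDomain_iff hH _).1 ht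
    rw [objective_eq_log hH, ← hmgf, ← integral_const_mul,
      ofReal_integral_eq_lintegral_ofReal (hti.const_mul _)
        (ae_of_all _ fun x => by positivity)]
    simp_rw [Real.exp_add]
    rfl
  have hc : Continuous fun t : ℝ => θ + t • v := by fun_prop
  have hmin : IsLocalMin (fun t => Real.exp (q t) * mgf X (limitMeasure μ H y) t) 0 := by
    filter_upwards [hc.continuousAt.eventually_mem (hΘ.mem_nhds (by simpa using hθ))] with t ht
    have h1 : objective μ H y (θ + (0 : ℝ) • v) ≤ objective μ H y (θ + t • v) := by
      simpa using isMinOn_thetaStar (μ := μ) hH y (Set.mem_univ (θ + t • v))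
    rw [hobj t ht, hobj 0 (by simpa using hθ), ENNReal.log_le_log_iff] at h1
    have h2 := (ENNReal.ofReal_le_ofReal_iff (by
      have := mgf_nonneg (X := X) (μ := limitMeasure μ H y) (t := t)
      positivity)).1 h1
    have h3 : Z * (Real.exp (q 0) * mgf X (limitMeasure μ H y) 0) ≤
        Z * (Real.exp (q t) * mgf X (limitMeasure μ H y) t) := by linarith
    exact le_of_mul_le_mul_left h3 hZpos
  have hqd : HasDerivAt q ⟪θ - y, v⟫ 0 := by
    have h1 : HasDerivAt (fun t : ℝ => θ + t • v - y) v 0 := by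
      simpa using (((hasDerivAt_id (0 : ℝ)).smul_const v).const_add θ).sub_const y
    have h2 := (h1.norm_sq).const_mul (1 / 2 : ℝ)
    simpa [hq] using h2
  have hmd := hasDerivAt_mgf hint
  have hder := (hqd.exp.mul hmd)
  have h0 := hmin.hasDerivAt_eq_zero hder
  have hone : mgf X (expFamily μ H θ) 0 = 1 := mgf_zero (μ := limitMeasure μ H y)
  simp only [hone, zero_mul, Real.exp_zero, mul_one] at h0
  rw [← mul_add] at h0
  have h1 := (mul_eq_zero.1 h0).resolve_left (Real.exp_pos _).ne'
  rw [← neg_sub θ y, inner_neg_right, real_inner_comm]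
  exact (neg_eq_of_add_eq_zero_right h1).symm

theorem memLp_inner_limitMeasure [IsProbabilityMeasure μ] (hH : Measurable H)
    (y : EuclideanSpace ℝ (Fin n)) (hΘ : IsOpen (cumulantDomain μ H))
    (v : EuclideanSpace ℝ (Fin n)) :
    MemLp (fun x => ⟪v, H x⟫) 2 (limitMeasure μ H y) :=
  memLp_of_mem_interior_integrableExpSet
    (zero_mem_interior_integrableExpSet hH hΘ (thetaStar_mem_cumulantDomain hH y) v) 2

/-- The posterior as a Gaussian mean-field perturbation of the product of the limit measures. -/
theorem posterior_eq_tilted_pi_limitMeasure [IsProbabilityMeasure μ] (hH : Measurable H)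
    (y : EuclideanSpace ℝ (Fin n)) {N : ℕ} (hN : 1 ≤ N) :
    posterior μ H y N = (Measure.pi fun _ : Fin N => limitMeasure μ H y).tilted fun x =>
      -(N / 2 * ‖(1 / (N : ℝ)) • ∑ i, H (x i) - (y - thetaStar μ H y)‖ ^ 2) := by
  have hN' : (N : ℝ) ≠ 0 := by positivity
  have hint := integrable_exp_inner_thetaStar (μ := μ) hH y
  -- This constant cancels the one left by expanding the square; the cross term `⟪y - θ_*, S⟫` and
  -- the tilt `⟪θ_*, S⟫` then add up to `⟪y, S⟫`.
  rw [← tilted_add_const _ _ (N / 2 * ‖y - thetaStar μ H y‖ ^ 2)]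
  simp_rw [limitMeasure, expFamily]
  rw [pi_tilted μ hint, tilted_tilted]
  · rw [posterior]
    congr 1
    ext x
    set S := ∑ i, H (x i) with hS
    have h1 : ∀ w, ∑ i, ⟪w, H (x i)⟫ = ⟪w, S⟫ := fun w => by rw [hS, inner_sum]
    have h2 : ∑ i, ∑ j, ⟪H (x i), H (x j)⟫ = ‖S‖ ^ 2 := by
      rw [← real_inner_self_eq_norm_sq, hS, sum_inner]
      simp_rw [inner_sum]
    rw [Pi.add_apply, h1, h1, h2, norm_sub_sq_real, norm_smul, real_inner_smul_left, mul_pow,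
      Real.norm_eq_abs, sq_abs, real_inner_comm _ S, inner_sub_left]
    field_simp
    ring
  · simp_rw [Real.exp_sum]
    exact Integrable.fintype_prod fun _ => hint

/-- Non-asymptotic Gaussian concentration of empirical means under the posterior. -/
theorem exists_posterior_norm_average_sub_ge_le {m : ℕ} [IsProbabilityMeasure μ]
    (hH : Measurable H) (y : EuclideanSpace ℝ (Fin n)) (hΘ : IsOpen (cumulantDomain μ H))
    {g : EuclideanSpace ℝ (Fin d) → EuclideanSpace ℝ (Fin m)} (hg : Measurable g)
    (hgb : ∃ M : ℝ, ∀ x, ‖g x‖ ≤ M) :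
    ∃ c : ℝ, 0 < c ∧ ∃ A : ℝ, ∀ N : ℕ, 1 ≤ N → ∀ l : ℝ, 0 < l →
      posterior μ H y N {x | l / √(N : ℝ) ≤
          ‖(1 / (N : ℝ)) • ∑ i, g (x i) - ∫ z, g z ∂(limitMeasure μ H y)‖} ≤
        ENNReal.ofReal (Real.exp (-c * l ^ 2 + A)) := by
  obtain ⟨M₀, hM₀⟩ := hgb
  -- A positive bound is needed for the rate `c` to be positive.
  set M := max M₀ 1 with hMdef
  have hM : ∀ x, ‖g x‖ ≤ M := fun x => (hM₀ x).trans (le_max_left _ _)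
  have hMpos : 0 < M := lt_max_of_lt_right one_pos
  have hprob : IsProbabilityMeasure (limitMeasure μ H y) :=
    isProbabilityMeasure_tilted (integrable_exp_inner_thetaStar hH y)
  have hcoord : ∀ k, (fun x => H x k) = fun x => ⟪EuclideanSpace.single k (1 : ℝ), H x⟫ :=
    fun k => by ext x; simp [EuclideanSpace.inner_single_left]
  set D := 1 / 2 * ∑ k, Var[fun x => H x k; limitMeasure μ H y] with hD
  -- `D` pays for the normalizing constant and `2 * m` for the union bound; the `+ 1` keeps the
  -- logarithm's argument positive when `m = 0`.
  refine ⟨1 / (2 * ((m + 1) * M) ^ 2), by positivity, D + Real.log (2 * m + 1),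
    fun N hN l hl => ?_⟩
  have hN' : (0 : ℝ) < N := by positivity
  have hZ := le_integral_exp_neg_sq_average (limitMeasure μ H y) (Y := H)
    (a := y - thetaStar μ H y)
    (fun k => by
      rw [hcoord]
      exact memLp_inner_limitMeasure hH y hΘ _)
    (fun k => by
      have := integral_inner_limitMeasure (μ := μ) hH y hΘ (EuclideanSpace.single k (1 : ℝ))
      simpa [EuclideanSpace.inner_single_left] using this) hN
  rw [posterior_eq_tilted_pi_limitMeasure hH y hN]
  refine (tilted_apply_le_of_nonpos _ (fun x => neg_nonpos.2 (by positivity))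
    (Real.exp_pos _) hZ _).trans ?_
  have hhoef := measure_norm_average_sub_ge_le (limitMeasure μ H y) hg hM hN
    (t := l / √(N : ℝ)) (by positivity)
  rw [← ofReal_measureReal, ← ENNReal.ofReal_mul (by positivity)]
  refine ENNReal.ofReal_le_ofReal ((mul_le_mul_of_nonneg_left hhoef (by positivity)).trans ?_)
  rw [← Real.exp_neg, neg_neg, ← hD, div_pow, Real.sq_sqrt hN'.le, mul_div_cancel₀ _ hN'.ne',
    Real.exp_add, Real.exp_add, Real.exp_log (by positivity)]
  have e : -(l ^ 2 / (2 * ((m + 1) * M) ^ 2)) = -(1 / (2 * ((m + 1) * M) ^ 2)) * l ^ 2 := by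
    field_simp
  rw [e]
  have hp := mul_pos (Real.exp_pos D)
    (Real.exp_pos (-(1 / (2 * ((m + 1) * M) ^ 2)) * l ^ 2))
  nlinarith

end FirstOrder

end MeanField

theorem proposition5 {d n m : ℕ}
    (μ : Measure (EuclideanSpace ℝ (Fin d))) [IsProbabilityMeasure μ]
    (H : EuclideanSpace ℝ (Fin d) → EuclideanSpace ℝ (Fin n)) (hH : Measurable H)
    (y : EuclideanSpace ℝ (Fin n))
    (hΘ : IsOpen (MeanField.cumulantDomain μ H))
    (hspan : ∀ v : EuclideanSpace ℝ (Fin n), v ≠ 0 → ∀ b : ℝ, ¬ ∀ᵐ x ∂μ, ⟪v, H x⟫ = b)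
    (g : EuclideanSpace ℝ (Fin d) → EuclideanSpace ℝ (Fin m)) (hg : Measurable g)
    (hgb : ∃ M : ℝ, ∀ x, ‖g x‖ ≤ M) :
    ∃ c : ℝ, 0 < c ∧
      ∀ lam : ℕ → ℝ, Tendsto lam atTop atTop →
        Tendsto (fun N : ℕ => lam N ^ 2 / (N : ℝ)) atTop (𝓝 0) →
        ∃ r : ℕ → ℝ, r =o[atTop] (fun N => lam N ^ 2) ∧
          ∀ N : ℕ, 1 ≤ N →
            MeanField.posterior μ H y N
                {x | lam N / √(N : ℝ) ≤
                  ‖((1 / (N : ℝ)) • ∑ i, g (x i)) - ∫ z, g z ∂(MeanField.limitMeasure μ H y)‖}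
              ≤ ENNReal.ofReal (Real.exp (-c * lam N ^ 2 + r N)) := by
  obtain ⟨c, hc, A, hA⟩ := MeanField.exists_posterior_norm_average_sub_ge_le hH y hΘ hg hgb
  -- Where `lam N ≤ 0`, which happens for finitely many `N` only, the remainder cancels the exponent
  -- and the bound is the trivial `1`.
  refine ⟨c, hc, fun lam hlam _ => ⟨fun N => if 0 < lam N then A else c * lam N ^ 2, ?_, ?_⟩⟩
  · have hconst : (fun _ : ℕ => A) =o[atTop] fun N => lam N ^ 2 :=
      isLittleO_const_left.2 (Or.inr (tendsto_norm_atTop_atTop.comp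
        ((tendsto_pow_atTop two_ne_zero).comp hlam)))
    refine hconst.congr' ?_ EventuallyEq.rfl
    filter_upwards [hlam.eventually_gt_atTop 0] with N hN
    rw [if_pos hN]
  · intro N hN
    dsimp only
    split_ifs with hl
    · exact hA N hN (lam N) hl
    · have := MeanField.isProbabilityMeasure_posterior (μ := μ) hH y hN
      rw [show -c * lam N ^ 2 + c * lam N ^ 2 = 0 by ring, Real.exp_zero, ENNReal.ofReal_one]
      exact prob_le_one
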